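/- All cardinal functions are taken to be infinite: for a topological space $Y$, the $\pi$-weight $\pi w(Y)$ is the least cardinality of a $\pi$-base of $Y$ (a family of non-empty open sets such that every non-empty open set contains a member of it), plus $\omega$; the cellularity $c(Y)$ is the supremum of the cardinalities of families of pairwise disjoint non-empty open subsets of $Y$, plus $\omega$. A space $Y$ is selectively highly divergent (SHD) if for every sequence $(U_n)_{n\in\omega}$ of non-empty open subsets of $Y$ there are points $x_n\in U_n$ such that $(x_n)$ has no convergent subsequence. A space is zero-dimensional if its clopen sets form a base, extremally disconnected if closures of open sets are open, and semiregular if its regular open sets form a base. For a Hausdorff space $X$ let $R(X)$ be the Boolean algebra of regular closed subsets of $X$, with order $\subseteq$ and meet $A\wedge B=\mathrm{cl}\,\mathrm{int}(A\cap B)$; let $\theta X$ be the set of ultrafilters of $R(X)$ with the topology generated by the sets $\lambda(A)=\{\mathscr U\in\theta X: A\in\mathscr U\}$, $A\in R(X)$; let $EX=\{\mathscr U\in\theta X:\bigcap\mathscr U\neq\emptyset\}$ be the Iliadis absolute, as a subspace of $\theta X$, and let $k_X:EX\to X$ be the map determined by $k_X(\mathscr U)\in\bigcap\mathscr U$. Theorem.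 Let $X$ be a Hausdorff space without isolated points. (I) There is an extremally disconnected zero-dimensional Hausdorff space $sX$ without isolated points, which is SHD, such that $|sX|=|X|$, $\pi w(sX)=\pi w(X)$ and $c(sX)=c(X)$. (II) There is a dense subspace $S$ of $EX$ that has exactly one point in each fiber of $k_X$, that is extremally disconnected, zero-dimensional, Hausdorff, without isolated points and SHD, and that satisfies $|S|=|X|$, $c(S)=c(X)$ and $\pi w(S)\le\pi w(X)$; if $X$ is semiregular, then also $\pi w(S)=\pi w(X)$, so that $S$ can serve as $sX$ in (I). -/

import Mathlib

open Set Filter Topology Cardinal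

universe u

namespace Absolute

/-- Selectively highly divergent spaces. -/
def IsSHD (X : Type u) [TopologicalSpace X] : Prop :=
  ∀ U : ℕ → Set X, (∀ n, IsOpen (U n) ∧ (U n).Nonempty) →
    ∃ x : ℕ → X, (∀ n, x n ∈ U n) ∧
      ∀ φ : ℕ → ℕ, StrictMono φ → ∀ a : X, ¬ Tendsto (x ∘ φ) atTop (𝓝 a)

/-- Zero-dimensional: the clopen sets form a base. -/
def IsZeroDimensional (X : Type u) [TopologicalSpace X] : Prop :=
  TopologicalSpace.IsTopologicalBasis {s : Set X | IsClopen s}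

/-- Semiregular: the regular open sets form a base. -/
def IsSemiregular (X : Type u) [TopologicalSpace X] : Prop :=
  TopologicalSpace.IsTopologicalBasis {s : Set X | interior (closure s) = s}

/-- A `π`-base: a family of non-empty open sets such that every non-empty open set
contains a member of the family. -/
def IsPiBase {X : Type u} [TopologicalSpace X] (B : Set (Set X)) : Prop :=
  (∀ V ∈ B, IsOpen V ∧ V.Nonempty) ∧
    ∀ U : Set X, IsOpen U → U.Nonempty → ∃ V ∈ B, V ⊆ U

/-- A cellular family: pairwise disjoint non-empty open sets. -/
def IsCellular {X : Type u} [TopologicalSpace X] (C : Set (Set X)) : Prop :=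
  (∀ V ∈ C, IsOpen V ∧ V.Nonempty) ∧ C.PairwiseDisjoint id

/-- The `π`-weight, with the usual convention that cardinal functions are infinite. -/
noncomputable def piWeight (X : Type u) [TopologicalSpace X] : Cardinal.{u} :=
  sInf {κ : Cardinal.{u} | ∃ B : Set (Set X), IsPiBase B ∧ #B = κ} + ℵ₀

/-- The cellularity, with the usual convention that cardinal functions are infinite. -/
noncomputable def cellularity (X : Type u) [TopologicalSpace X] : Cardinal.{u} :=
  sSup {κ : Cardinal.{u} | ∃ C : Set (Set X), IsCellular C ∧ #C = κ} + ℵ₀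

/-- `A` is regular closed. -/
def IsRegClosed {X : Type u} [TopologicalSpace X] (A : Set X) : Prop :=
  closure (interior A) = A

/-- Proper filters of the Boolean algebra of regular closed sets, in which the order is inclusion
and the meet of `A` and `B` is `closure (interior (A ∩ B))`. -/
structure IsRegFilter {X : Type u} [TopologicalSpace X] (F : Set (Set X)) : Prop where
  regClosed : ∀ A ∈ F, IsRegClosed A
  nonempty : F.Nonempty
  empty_notMem : ∅ ∉ F
  meet_mem : ∀ A ∈ F, ∀ B ∈ F, closure (interior (A ∩ B)) ∈ F
  mono : ∀ A ∈ F, ∀ B, IsRegClosed B → A ⊆ B → B ∈ F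

/-- Ultrafilters of regular closed sets: the maximal proper filters. -/
def IsRegUltrafilter {X : Type u} [TopologicalSpace X] (F : Set (Set X)) : Prop :=
  Maximal IsRegFilter F

/-- The space `θX` of ultrafilters of regular closed sets. -/
def Theta (X : Type u) [TopologicalSpace X] : Type u :=
  {F : Set (Set X) // IsRegUltrafilter F}

/-- The set `λ(A)` of the ultrafilters that contain `A`. -/
def lam {X : Type u} [TopologicalSpace X] (A : Set X) : Set (Theta X) :=
  {F | A ∈ F.1}

/-- The topology of `θX` generated by the sets `λ(A)`, `A` regular closed. -/
instance instTopologicalSpaceTheta (X : Type u) [TopologicalSpace X] :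
    TopologicalSpace (Theta X) :=
  TopologicalSpace.generateFrom {s | ∃ A : Set X, IsRegClosed A ∧ s = lam A}

/-- The Iliadis absolute `EX`: the subspace of fixed ultrafilters. -/
abbrev IliadisAbsolute (X : Type u) [TopologicalSpace X] : Type u :=
  {F : Theta X // (⋂₀ F.1).Nonempty}

/-- The map `k_X : EX → X` with `k_X(F) ∈ ⋂ F`. -/
noncomputable def kMap (X : Type u) [TopologicalSpace X] (F : IliadisAbsolute X) : X :=
  F.2.some

theorem isRegClosed_closure {X : Type u} [TopologicalSpace X] {V : Set X} (hV : IsOpen V) :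
    IsRegClosed (closure V) := by
  refine subset_antisymm ?_ (closure_mono hV.subset_interior_closure)
  exact closure_minimal interior_subset isClosed_closure

theorem IsRegUltrafilter.mem_or {X : Type u} [TopologicalSpace X] {F : Set (Set X)}
    (hF : IsRegUltrafilter F) {V : Set X} (hV : IsOpen V) :
    closure V ∈ F ∨ closure (closure V)ᶜ ∈ F := by
  have hf : IsRegFilter F := hF.1
  have hcl : ∀ A ∈ F, IsClosed A := fun A hA => by
    rw [← hf.regClosed A hA]; exact isClosed_closure
  let G : Set (Set X) :=
    {B | IsRegClosed B ∧ ∃ A ∈ F, interior (A ∩ closure V) ⊆ B}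
  by_cases hG : ∅ ∈ G
  · right
    obtain ⟨-, A, hA, hAV⟩ := hG
    refine hf.mono A hA _ (isRegClosed_closure isClosed_closure.isOpen_compl) ?_
    rw [← hf.regClosed A hA]
    refine closure_mono fun x hx hxV => ?_
    obtain ⟨y, hyA, hyV⟩ := mem_closure_iff.1 hxV _ isOpen_interior hx
    refine hAV (?_ : y ∈ interior (A ∩ closure V))
    rw [interior_inter]
    exact ⟨hyA, hV.subset_interior_closure hyV⟩
  · left
    have hGf : IsRegFilter G := by
      refine ⟨fun B hB => hB.1, ?_, hG, ?_, ?_⟩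
      · obtain ⟨A, hA⟩ := hf.nonempty
        exact ⟨A, hf.regClosed A hA, A, hA, interior_subset.trans inter_subset_left⟩
      · rintro B₁ ⟨-, A₁, hA₁, h₁⟩ B₂ ⟨-, A₂, hA₂, h₂⟩
        refine ⟨isRegClosed_closure isOpen_interior, _, hf.meet_mem A₁ hA₁ A₂ hA₂, ?_⟩
        have hsub : closure (interior (A₁ ∩ A₂)) ⊆ A₁ ∩ A₂ :=
          closure_minimal interior_subset ((hcl A₁ hA₁).inter (hcl A₂ hA₂))
        refine subset_trans (interior_maximal ?_ isOpen_interior) subset_closure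
        exact subset_inter
          ((interior_mono (inter_subset_inter_left _ (hsub.trans inter_subset_left))).trans h₁)
          ((interior_mono (inter_subset_inter_left _ (hsub.trans inter_subset_right))).trans h₂)
      · rintro B ⟨-, A, hA, h⟩ C hC hBC
        exact ⟨hC, A, hA, h.trans hBC⟩
    have hle : F ≤ G := fun A hA =>
      ⟨hf.regClosed A hA, A, hA, interior_subset.trans inter_subset_left⟩
    refine hF.2 hGf hle ⟨isRegClosed_closure hV, ?_⟩
    obtain ⟨A, hA⟩ := hf.nonempty
    exact ⟨A, hA, interior_subset.trans inter_subset_right⟩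

/-- For Hausdorff `X`, the condition `k_X(F) ∈ ⋂ F` determines `k_X(F)`. -/
theorem kMap_eq_iff {X : Type u} [TopologicalSpace X] [T2Space X] (F : IliadisAbsolute X) (x : X) :
    kMap X F = x ↔ x ∈ ⋂₀ F.1.1 := by
  have hk : kMap X F ∈ ⋂₀ F.1.1 := F.2.some_mem
  refine ⟨fun h => h ▸ hk, fun hx => ?_⟩
  by_contra hne
  obtain ⟨U, V, hU, hV, hkU, hxV, hUV⟩ := t2_separation hne
  rcases F.1.2.mem_or hU with h | h
  · obtain ⟨y, hyV, hyU⟩ := mem_closure_iff.1 (hx _ h) V hV hxV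
    exact hUV.le_bot ⟨hyU, hyV⟩
  · obtain ⟨y, hyU, hy⟩ := mem_closure_iff.1 (hk _ h) U hU hkU
    exact hy (subset_closure hyU)

end Absolute

/-!
A section `s` of `k_X` has dense image not only in `EX` but in `θX`: if `U` is a non-empty open set
and `x ∈ U`, then every ultrafilter converging to `x` contains `cl U`. As the Stone space of a
complete Boolean algebra, `θX` is Hausdorff, zero-dimensional and extremally disconnected, and all
of this passes to the dense subspace `S = s(X)`.

The map `U ↦ S ∩ λ(cl U)` is a dense embedding of the poset of non-empty open subsets of `X` into
that of `S`. It therefore preserves cellularity, does not increase `π`-weight, and preserves it when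
`X` is semiregular, since it determines `U` up to `int (cl U)`. A convergent sequence in an
extremally disconnected Hausdorff space is eventually constant, so in such a space without isolated
points an injective choice of points `x_n ∈ U_n` shows that the space is SHD.

When `X` is not semiregular the `π`-weight of `S` may drop. It is restored by a summand: since
`πw(X) ≤ 2^|X|`, the Cantor cube `2^πw(X)` has a dense subset `Z` of size at most `|X|`, and `Z` has
`π`-weight `πw(X)` and countable cellularity. The zero-dimensional space `S ⊕ Z` then has all three
cardinal functions of `X`, and it is semiregular, so `sX` can be taken to be the image of a section
of its own absolute.
-/

namespace Absolute

universe v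

section PerfectSpaces

variable {X : Type*} [TopologicalSpace X]

theorem perfectSpace_iff_forall_nontrivial :
    PerfectSpace X ↔ ∀ U : Set X, IsOpen U → U.Nonempty → U.Nontrivial := by
  simp only [perfectSpace_iff_forall_not_isolated, ← mem_closure_iff_nhdsWithin_neBot,
    mem_closure_iff]
  refine ⟨fun h U hU ⟨x, hx⟩ => ?_, fun h x U hU hx => (h U hU ⟨x, hx⟩).exists_ne x⟩
  obtain ⟨y, hy, hyx⟩ := h x U hU hx
  exact ⟨y, hy, x, hx, hyx⟩

theorem nontrivial_of_isOpen [PerfectSpace X] {U : Set X} (hU : IsOpen U) (hne : U.Nonempty) :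
    U.Nontrivial :=
  perfectSpace_iff_forall_nontrivial.1 ‹_› U hU hne

theorem infinite_of_isOpen [T1Space X] [PerfectSpace X] {U : Set X} (hU : IsOpen U)
    (hne : U.Nonempty) : U.Infinite :=
  let ⟨x, hx⟩ := hne
  infinite_of_mem_nhds x (hU.mem_nhds hx)

instance perfectSpace_sum {Y : Type*} [TopologicalSpace Y] [PerfectSpace X] [PerfectSpace Y] :
    PerfectSpace (X ⊕ Y) := by
  refine perfectSpace_iff_forall_nontrivial.2 ?_
  rintro U hU ⟨x | y, hz⟩
  · exact ((nontrivial_of_isOpen (hU.preimage continuous_inl) ⟨x, hz⟩).image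
      Sum.inl_injective).mono (image_preimage_subset _ _)
  · exact ((nontrivial_of_isOpen (hU.preimage continuous_inr) ⟨y, hz⟩).image
      Sum.inr_injective).mono (image_preimage_subset _ _)

end PerfectSpaces

section ZeroDimensional

variable {X Y : Type u} [TopologicalSpace X] [TopologicalSpace Y]

theorem IsZeroDimensional.of_isInducing (hY : IsZeroDimensional Y) {f : X → Y}
    (hf : IsInducing f) : IsZeroDimensional X := by
  refine (hY.isInducing hf).of_isOpen_of_subset (fun U hU => hU.2) ?_
  rintro _ ⟨V, hV, rfl⟩
  exact IsClopen.preimage hV hf.continuous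

theorem IsZeroDimensional.sum (hX : IsZeroDimensional X) (hY : IsZeroDimensional Y) :
    IsZeroDimensional (X ⊕ Y) := by
  refine (TopologicalSpace.IsTopologicalBasis.sum hX hY).of_isOpen_of_subset (fun U hU => hU.2) ?_
  rintro _ (⟨V, hV, rfl⟩ | ⟨V, hV, rfl⟩)
  · exact ⟨IsClosedEmbedding.inl.isClosedMap _ hV.1, isOpenMap_inl _ hV.2⟩
  · exact ⟨IsClosedEmbedding.inr.isClosedMap _ hV.1, isOpenMap_inr _ hV.2⟩

theorem IsZeroDimensional.isSemiregular (hX : IsZeroDimensional X) : IsSemiregular X := by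
  refine TopologicalSpace.IsTopologicalBasis.of_isOpen_of_subset
    (fun U (hU : interior (closure U) = U) => hU ▸ isOpen_interior) hX fun V hV => ?_
  rw [mem_ofPred_eq, hV.1.closure_eq, hV.2.interior_eq]

end ZeroDimensional

section ExtremallyDisconnected

variable {X : Type*} [TopologicalSpace X]

theorem closure_preimage_of_isDenseInducing {Y : Type*} [TopologicalSpace Y] {f : X → Y}
    (hf : IsDenseInducing f) {V : Set Y} (hV : IsOpen V) :
    closure (f ⁻¹' V) = f ⁻¹' closure V := by
  rw [hf.isInducing.closure_eq_preimage_closure_image]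
  refine congrArg (f ⁻¹' ·) ((closure_mono (image_preimage_subset f V)).antisymm ?_)
  exact closure_minimal (hf.dense.subset_closure_image_preimage_of_isOpen hV) isClosed_closure

theorem extremallyDisconnected_of_isDenseInducing {Y : Type*} [TopologicalSpace Y]
    [ExtremallyDisconnected Y] {f : X → Y} (hf : IsDenseInducing f) :
    ExtremallyDisconnected X := by
  refine ⟨fun U hU => ?_⟩
  obtain ⟨V, hV, rfl⟩ := hf.isInducing.isOpen_iff.1 hU
  rw [closure_preimage_of_isDenseInducing hf hV]
  exact (ExtremallyDisconnected.open_closure V hV).preimage hf.continuous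

theorem not_tendsto_of_pairwise_disjoint [ExtremallyDisconnected X] {x : ℕ → X} {W : ℕ → Set X}
    (hW : ∀ n, IsOpen (W n)) (hxW : ∀ n, x n ∈ W n)
    (hdisj : Pairwise (Function.onFun Disjoint W)) (a : X) : ¬ Tendsto x atTop (𝓝 a) := by
  intro hx
  have hlim {φ : ℕ → ℕ} (hφ : StrictMono φ) : a ∈ closure (⋃ k, W (φ k)) :=
    mem_closure_of_tendsto (hx.comp hφ.tendsto_atTop)
      (Eventually.of_forall fun k => mem_iUnion.2 ⟨k, hxW _⟩)
  have hparity : Disjoint (⋃ k, W (2 * k)) (⋃ k, W (2 * k + 1)) := by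
    simp only [disjoint_iUnion_left, disjoint_iUnion_right]
    exact fun i j => hdisj (by omega)
  have hclosures := ExtremallyDisconnected.disjoint_closure_of_disjoint_isOpen hparity
    (isOpen_iUnion fun k => hW _) (isOpen_iUnion fun k => hW _)
  exact hclosures.notMem_of_mem_left (hlim fun i j h => by omega) (hlim fun i j h => by omega)

theorem exists_pairwise_disjoint_isOpen_of_tendsto [T2Space X] {x : ℕ → X} {a : X}
    (hx : Tendsto x atTop (𝓝 a)) (hne : ∀ n, x n ≠ a) :
    ∃ φ : ℕ → ℕ, StrictMono φ ∧ ∃ W : ℕ → Set X, (∀ n, IsOpen (W n)) ∧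
      (∀ n, x (φ n) ∈ W n) ∧ Pairwise (Function.onFun Disjoint W) := by
  choose P Q hP hQ hxP haQ hPQ using fun n => t2_separation (hne n)
  obtain ⟨φ, -, hφ⟩ := exists_seq_of_forall_finset_exists (fun _ => True)
    (fun m n => m < n ∧ x n ∈ Q m) fun s _ => by
      have hlate : ∀ᶠ n in atTop, ∀ m ∈ s, m < n ∧ x n ∈ Q m :=
        (eventually_all_finset s).2 fun m _ =>
          (eventually_gt_atTop m).and (hx.eventually_mem ((hQ m).mem_nhds (haQ m)))
      exact hlate.exists.imp fun n hn => ⟨trivial, hn⟩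
  let W : ℕ → Set X := fun n => P (φ n) ∩ ⋂ m ∈ Finset.range n, Q (φ m)
  have hWlt {m n : ℕ} (h : m < n) : Disjoint (W m) (W n) :=
    (hPQ (φ m)).mono inter_subset_left
      (inter_subset_right.trans (biInter_subset_of_mem (Finset.mem_range.2 h)))
  refine ⟨φ, fun m n h => (hφ m n h).1, W, fun n => (hP _).inter
    (isOpen_biInter_finset fun m _ => hQ _), fun n => ⟨hxP _, mem_iInter₂.2 fun m hm =>
      (hφ m n (Finset.mem_range.1 hm)).2⟩, fun m n h => ?_⟩
  exact h.lt_or_gt.elim hWlt fun h => (hWlt h).symm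

theorem eventually_eq_of_tendsto [T2Space X] [ExtremallyDisconnected X] {x : ℕ → X} {a : X}
    (hx : Tendsto x atTop (𝓝 a)) : ∀ᶠ n in atTop, x n = a := by
  by_contra h
  obtain ⟨φ, hφ, hne⟩ := extraction_of_frequently_atTop (not_eventually.1 h)
  obtain ⟨ψ, hψ, W, hWo, hxW, hW⟩ :=
    exists_pairwise_disjoint_isOpen_of_tendsto (hx.comp hφ.tendsto_atTop) hne
  exact not_tendsto_of_pairwise_disjoint hWo hxW hW a
    ((hx.comp hφ.tendsto_atTop).comp hψ.tendsto_atTop)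

theorem exists_injective_choice {α : Type*} {U : ℕ → Set α} (hU : ∀ n, (U n).Infinite) :
    ∃ x : ℕ → α, Function.Injective x ∧ ∀ n, x n ∈ U n := by
  classical
  choose T hTU hT using fun n => (hU n).exists_subset_card_eq (n + 1)
  have hall (s : Finset ℕ) : s.card ≤ (s.biUnion T).card := by
    rcases s.eq_empty_or_nonempty with rfl | hs
    · exact Nat.zero_le _
    calc s.card ≤ (Finset.range (s.max' hs + 1)).card :=
          Finset.card_le_card fun i hi =>
            Finset.mem_range.2 (Nat.lt_succ_of_le (s.le_max' i hi))
      _ = (T (s.max' hs)).card := by rw [Finset.card_range, hT]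
      _ ≤ (s.biUnion T).card :=
          Finset.card_le_card (Finset.subset_biUnion_of_mem T (s.max'_mem hs))
  obtain ⟨x, hx, hxT⟩ := (Finset.all_card_le_biUnion_card_iff_exists_injective T).1 hall
  exact ⟨x, hx, fun n => hTU n (hxT n)⟩

end ExtremallyDisconnected

theorem isSHD_of_extremallyDisconnected (X : Type u) [TopologicalSpace X] [T2Space X]
    [ExtremallyDisconnected X] [PerfectSpace X] : IsSHD X := by
  intro U hU
  obtain ⟨x, hx, hxU⟩ := exists_injective_choice fun n => infinite_of_isOpen (hU n).1 (hU n).2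
  refine ⟨x, hxU, fun φ hφ a hlim => ?_⟩
  obtain ⟨N, hN⟩ := eventually_atTop.1 (eventually_eq_of_tendsto hlim)
  have heq : x (φ N) = x (φ (N + 1)) := (hN N le_rfl).trans (hN (N + 1) N.le_succ).symm
  exact N.lt_succ_self.ne (hφ.injective (hx heq))

section CardinalFunctions

variable {X Y : Type u} [TopologicalSpace X] [TopologicalSpace Y]

theorem aleph0_le_piWeight : ℵ₀ ≤ piWeight X :=
  self_le_add_left _ _

theorem aleph0_le_cellularity : ℵ₀ ≤ cellularity X :=
  self_le_add_left _ _

theorem exists_isPiBase_mk_le_piWeight (X : Type u) [TopologicalSpace X] :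
    ∃ B : Set (Set X), IsPiBase B ∧ #B ≤ piWeight X := by
  have hne : {κ : Cardinal.{u} | ∃ B : Set (Set X), IsPiBase B ∧ #B = κ}.Nonempty :=
    ⟨_, {V | IsOpen V ∧ V.Nonempty}, ⟨fun _ h => h, fun U hU h => ⟨U, ⟨hU, h⟩, subset_rfl⟩⟩, rfl⟩
  obtain ⟨B, hB, h⟩ := csInf_mem hne
  exact ⟨B, hB, h.trans_le (self_le_add_right _ _)⟩

theorem piWeight_le_of_family {ι : Type u} {κ : Cardinal.{u}} (hκ : ℵ₀ ≤ κ) (hι : #ι ≤ κ)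
    (f : ι → Set X) (ho : ∀ i, IsOpen (f i)) (hne : ∀ i, (f i).Nonempty)
    (hf : ∀ U : Set X, IsOpen U → U.Nonempty → ∃ i, f i ⊆ U) : piWeight X ≤ κ := by
  have hB : IsPiBase (range f) :=
    ⟨forall_mem_range.2 fun i => ⟨ho i, hne i⟩, fun U hU h => exists_range_iff.2 (hf U hU h)⟩
  refine Cardinal.add_le_of_le hκ ?_ hκ
  exact (csInf_le' (mem_ofPred.2 ⟨range f, hB, rfl⟩)).trans (mk_range_le.trans hι)

theorem piWeight_le_mk_set [Infinite X] : piWeight X ≤ #(Set X) :=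
  piWeight_le_of_family (ι := {V : Set X // IsOpen V ∧ V.Nonempty}) (aleph0_le_mk _)
    (mk_subtype_le _) Subtype.val (fun V => V.2.1) (fun V => V.2.2)
    fun U hU h => ⟨⟨U, hU, h⟩, subset_rfl⟩

theorem piWeight_le_aleph0 [SecondCountableTopology X] : piWeight X ≤ ℵ₀ := by
  obtain ⟨B, hBc, hBne, hB⟩ := TopologicalSpace.exists_countable_basis X
  refine piWeight_le_of_family le_rfl (mk_le_aleph0_iff.2 hBc) ((↑) : B → Set X)
    (fun V => hB.isOpen V.2)
    (fun V => nonempty_iff_ne_empty.2 (ne_of_mem_of_not_mem V.2 hBne)) fun U hU hne => ?_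
  obtain ⟨V, hV, -, hVU⟩ := hB.exists_nonempty_subset hne hU
  exact ⟨⟨V, hV⟩, hVU⟩

theorem mk_le_cellularity {ι : Type u} (f : ι → Set X) (ho : ∀ i, IsOpen (f i))
    (hne : ∀ i, (f i).Nonempty) (hf : Pairwise (Function.onFun Disjoint f)) :
    #ι ≤ cellularity X := by
  have hinj : Function.Injective f := fun i j h => by
    by_contra hij
    have hdisj : Disjoint (f i) (f j) := hf hij
    rw [h, disjoint_self] at hdisj
    exact (hne j).ne_empty hdisj
  have hC : IsCellular (range f) :=
    ⟨forall_mem_range.2 fun i => ⟨ho i, hne i⟩, pairwiseDisjoint_range_iff.2 fun i j h =>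
      hf fun hij => h (congrArg f hij)⟩
  have hbdd : BddAbove {κ : Cardinal.{u} | ∃ C : Set (Set X), IsCellular C ∧ #C = κ} := by
    refine ⟨#(Set X), ?_⟩
    rintro _ ⟨C, -, rfl⟩
    exact mk_set_le C
  rw [← mk_range_eq f hinj]
  exact (le_csSup hbdd ⟨range f, hC, rfl⟩).trans (self_le_add_right _ _)

theorem cellularity_le {κ : Cardinal.{u}} (hκ : ℵ₀ ≤ κ)
    (h : ∀ C : Set (Set X), IsCellular C → #C ≤ κ) : cellularity X ≤ κ := by
  refine Cardinal.add_le_of_le hκ (csSup_le' ?_) hκ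
  rintro _ ⟨C, hC, rfl⟩
  exact h C hC

theorem IsCellular.disjoint {C : Set (Set X)} (hC : IsCellular C) {V W : C} (h : V ≠ W) :
    Disjoint V.1 W.1 :=
  hC.2 V.2 W.2 (Subtype.coe_injective.ne h)

/-- A dense embedding of the poset of non-empty open subsets of `X` into that of `Y`, given by a map
on all subsets that is only constrained on open ones. It carries `π`-bases to `π`-bases and cellular
families to cellular families, so that the spaces can be compared without a map between them. -/
structure IsPiEmbedding (T : Set X → Set Y) : Prop where
  isOpen : ∀ {U}, IsOpen U → IsOpen (T U)
  nonempty : ∀ {U}, IsOpen U → U.Nonempty → (T U).Nonempty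
  mono : ∀ {U V}, IsOpen U → IsOpen V → U ⊆ V → T U ⊆ T V
  disjoint : ∀ {U V}, IsOpen U → IsOpen V → Disjoint U V → Disjoint (T U) (T V)
  exists_subset : ∀ {W}, IsOpen W → W.Nonempty → ∃ U, IsOpen U ∧ U.Nonempty ∧ T U ⊆ W

namespace IsPiEmbedding

variable {T : Set X → Set Y} {U V : Set X}

theorem comp {Z : Type u} [TopologicalSpace Z] {T' : Set Y → Set Z} (hT' : IsPiEmbedding T')
    (hT : IsPiEmbedding T) : IsPiEmbedding (T' ∘ T) where
  isOpen hU := hT'.isOpen (hT.isOpen hU)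
  nonempty hU hne := hT'.nonempty (hT.isOpen hU) (hT.nonempty hU hne)
  mono hU hV h := hT'.mono (hT.isOpen hU) (hT.isOpen hV) (hT.mono hU hV h)
  disjoint hU hV h := hT'.disjoint (hT.isOpen hU) (hT.isOpen hV) (hT.disjoint hU hV h)
  exists_subset hW hne := by
    obtain ⟨V, hV, hVne, hVW⟩ := hT'.exists_subset hW hne
    obtain ⟨U, hU, hUne, hUV⟩ := hT.exists_subset hV hVne
    exact ⟨U, hU, hUne, (hT'.mono (hT.isOpen hU) hV hUV).trans hVW⟩

theorem disjoint_of_disjoint (hT : IsPiEmbedding T) (hU : IsOpen U) (hV : IsOpen V)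
    (h : Disjoint (T U) (T V)) : Disjoint U V := by
  by_contra hUV
  obtain ⟨y, hy⟩ := hT.nonempty (hU.inter hV) (not_disjoint_iff_nonempty_inter.1 hUV)
  exact disjoint_left.1 h (hT.mono (hU.inter hV) hU inter_subset_left hy)
    (hT.mono (hU.inter hV) hV inter_subset_right hy)

theorem subset_closure_of_subset (hT : IsPiEmbedding T) (hU : IsOpen U) (hV : IsOpen V)
    (h : T U ⊆ T V) : U ⊆ closure V := by
  have hO : IsOpen (U \ closure V) := hU.sdiff isClosed_closure
  refine sdiff_eq_empty.1 (not_nonempty_iff_eq_empty.1 fun hne => ?_)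
  obtain ⟨y, hy⟩ := hT.nonempty hO hne
  exact disjoint_left.1 (hT.disjoint hO hV (disjoint_sdiff_left.mono_right subset_closure)) hy
    (h (hT.mono hO hU sdiff_subset hy))

theorem cellularity_eq (hT : IsPiEmbedding T) : cellularity Y = cellularity X := by
  refine le_antisymm (cellularity_le aleph0_le_cellularity fun C hC => ?_)
    (cellularity_le aleph0_le_cellularity fun C hC => ?_)
  · choose U hU hne hUV using fun V : C => hT.exists_subset (hC.1 V V.2).1 (hC.1 V V.2).2
    exact mk_le_cellularity U hU hne fun V W h =>
      hT.disjoint_of_disjoint (hU V) (hU W) ((hC.disjoint h).mono (hUV V) (hUV W))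
  · exact mk_le_cellularity (fun V : C => T V) (fun V => hT.isOpen (hC.1 V V.2).1)
      (fun V => hT.nonempty (hC.1 V V.2).1 (hC.1 V V.2).2) fun V W h =>
        hT.disjoint (hC.1 V V.2).1 (hC.1 W W.2).1 (hC.disjoint h)

theorem piWeight_le (hT : IsPiEmbedding T) : piWeight Y ≤ piWeight X := by
  obtain ⟨B, hB, hBX⟩ := exists_isPiBase_mk_le_piWeight X
  refine piWeight_le_of_family aleph0_le_piWeight hBX (fun V : B => T V)
    (fun V => hT.isOpen (hB.1 V V.2).1)
    (fun V => hT.nonempty (hB.1 V V.2).1 (hB.1 V V.2).2) fun W hW hne => ?_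
  obtain ⟨U, hU, hUne, hUW⟩ := hT.exists_subset hW hne
  obtain ⟨V, hV, hVU⟩ := hB.2 U hU hUne
  exact ⟨⟨V, hV⟩, (hT.mono (hB.1 V hV).1 hU hVU).trans hUW⟩

theorem piWeight_eq (hT : IsPiEmbedding T) (hX : IsSemiregular X) : piWeight Y = piWeight X := by
  refine hT.piWeight_le.antisymm ?_
  obtain ⟨B, hB, hBY⟩ := exists_isPiBase_mk_le_piWeight Y
  choose U hU hne hUV using fun V : B => hT.exists_subset (hB.1 V V.2).1 (hB.1 V V.2).2
  refine piWeight_le_of_family aleph0_le_piWeight hBY U hU hne fun O hO hOne => ?_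
  obtain ⟨R, hR, hRne, hRO⟩ := hX.exists_nonempty_subset hOne hO
  have hRo : IsOpen R := hX.isOpen hR
  obtain ⟨V, hV, hVR⟩ := hB.2 _ (hT.isOpen hRo) (hT.nonempty hRo hRne)
  have hUR : U ⟨V, hV⟩ ⊆ closure R :=
    hT.subset_closure_of_subset (hU _) hRo ((hUV ⟨V, hV⟩).trans hVR)
  refine ⟨⟨V, hV⟩, (interior_maximal hUR (hU _)).trans ?_⟩
  exact (hR : interior (closure R) = R).trans_subset hRO

theorem perfectSpace (hT : IsPiEmbedding T) [T2Space X] [PerfectSpace X] : PerfectSpace Y := by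
  refine perfectSpace_iff_forall_nontrivial.2 fun W hW hne => ?_
  obtain ⟨U, hU, hUne, hUW⟩ := hT.exists_subset hW hne
  obtain ⟨x, hx, y, hy, hxy⟩ := nontrivial_of_isOpen hU hUne
  obtain ⟨P, Q, hP, hQ, hxP, hyQ, hPQ⟩ := t2_separation hxy
  obtain ⟨p, hp⟩ := hT.nonempty (hU.inter hP) ⟨x, hx, hxP⟩
  obtain ⟨q, hq⟩ := hT.nonempty (hU.inter hQ) ⟨y, hy, hyQ⟩
  have hpq := hT.disjoint (hU.inter hP) (hU.inter hQ)
    (hPQ.mono inter_subset_right inter_subset_right)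
  exact ⟨p, hUW (hT.mono (hU.inter hP) hU inter_subset_left hp), q,
    hUW (hT.mono (hU.inter hQ) hU inter_subset_left hq), hpq.ne_of_mem hp hq⟩

end IsPiEmbedding

theorem isPiEmbedding_preimage {f : X → Y} (hf : IsDenseInducing f) :
    IsPiEmbedding (f ⁻¹' · : Set Y → Set X) where
  isOpen hU := hU.preimage hf.continuous
  nonempty hU hne := hf.dense.exists_mem_open hU hne
  mono _ _ h := preimage_mono h
  disjoint _ _ h := h.preimage f
  exists_subset := by
    rintro W hW ⟨x, hx⟩
    obtain ⟨V, hV, rfl⟩ := hf.isInducing.isOpen_iff.1 hW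
    exact ⟨V, hV, ⟨f x, hx⟩, subset_rfl⟩

theorem piWeight_sum_le :
    piWeight (X ⊕ Y) ≤ max (piWeight X) (piWeight Y) := by
  have hκ : ℵ₀ ≤ max (piWeight X) (piWeight Y) := aleph0_le_piWeight.trans (le_max_left _ _)
  obtain ⟨B, hB, hBX⟩ := exists_isPiBase_mk_le_piWeight X
  obtain ⟨D, hD, hDY⟩ := exists_isPiBase_mk_le_piWeight Y
  refine piWeight_le_of_family (ι := B ⊕ D) hκ ?_
    (Sum.elim (fun V => Sum.inl '' V.1) fun V => Sum.inr '' V.1)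
    (Sum.rec (fun V => isOpenMap_inl _ (hB.1 V V.2).1) fun V => isOpenMap_inr _ (hD.1 V V.2).1)
    (Sum.rec (fun V => (hB.1 V V.2).2.image _) fun V => (hD.1 V V.2).2.image _) ?_
  · rw [← Cardinal.add_def]
    exact Cardinal.add_le_of_le hκ (hBX.trans (le_max_left _ _)) (hDY.trans (le_max_right _ _))
  · rintro U hU ⟨x | y, hz⟩
    · obtain ⟨V, hV, hVU⟩ := hB.2 _ (hU.preimage continuous_inl) ⟨x, hz⟩
      exact ⟨Sum.inl ⟨V, hV⟩, image_subset_iff.2 hVU⟩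
    · obtain ⟨V, hV, hVU⟩ := hD.2 _ (hU.preimage continuous_inr) ⟨y, hz⟩
      exact ⟨Sum.inr ⟨V, hV⟩, image_subset_iff.2 hVU⟩

theorem piWeight_le_of_isOpenEmbedding {f : X → Y} (hf : IsOpenEmbedding f) :
    piWeight X ≤ piWeight Y := by
  obtain ⟨B, hB, hBY⟩ := exists_isPiBase_mk_le_piWeight Y
  refine piWeight_le_of_family (ι := {V : B // (f ⁻¹' V.1).Nonempty}) aleph0_le_piWeight
    ((mk_subtype_le _).trans hBY) (fun V => f ⁻¹' V.1.1)
    (fun V => (hB.1 _ V.1.2).1.preimage hf.continuous) (fun V => V.2) fun U hU hne => ?_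
  obtain ⟨V, hV, hVU⟩ := hB.2 _ (hf.isOpenMap U hU) (hne.image f)
  obtain ⟨_, hv⟩ := (hB.1 V hV).2
  obtain ⟨x, -, rfl⟩ := hVU hv
  exact ⟨⟨⟨V, hV⟩, x, hv⟩,
    (preimage_mono hVU).trans (preimage_image_eq U hf.injective).subset⟩

theorem cellularity_le_of_isOpenEmbedding {f : X → Y} (hf : IsOpenEmbedding f) :
    cellularity X ≤ cellularity Y :=
  cellularity_le aleph0_le_cellularity fun C hC =>
    mk_le_cellularity (fun V : C => f '' V) (fun V => hf.isOpenMap _ (hC.1 V V.2).1)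
      (fun V => (hC.1 V V.2).2.image f) fun _ _ h =>
        (disjoint_image_iff hf.injective).2 (hC.disjoint h)

theorem piWeight_sum : piWeight (X ⊕ Y) = max (piWeight X) (piWeight Y) :=
  piWeight_sum_le.antisymm <| max_le (piWeight_le_of_isOpenEmbedding .inl)
    (piWeight_le_of_isOpenEmbedding .inr)

theorem IsCellular.mk_preimage_nonempty_le {C : Set (Set Y)} (hC : IsCellular C) {f : X → Y}
    (hf : Continuous f) : #{V : C | (f ⁻¹' V).Nonempty} ≤ cellularity X :=
  mk_le_cellularity (fun V => f ⁻¹' V.1.1) (fun V => (hC.1 _ V.1.2).1.preimage hf) (fun V => V.2)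
    fun _ _ h => (hC.disjoint (Subtype.coe_injective.ne h)).preimage f

theorem cellularity_sum_le :
    cellularity (X ⊕ Y) ≤ max (cellularity X) (cellularity Y) := by
  have hκ : ℵ₀ ≤ max (cellularity X) (cellularity Y) :=
    aleph0_le_cellularity.trans (le_max_left _ _)
  refine cellularity_le hκ fun C hC => ?_
  have hcover : {V : C | (Sum.inl ⁻¹' V.1 : Set X).Nonempty} ∪
      {V : C | (Sum.inr ⁻¹' V.1 : Set Y).Nonempty} = Set.univ := by
    refine eq_univ_of_forall fun V => ?_
    obtain ⟨x | y, hz⟩ := (hC.1 V V.2).2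
    exacts [Or.inl ⟨x, hz⟩, Or.inr ⟨y, hz⟩]
  rw [← mk_univ, ← hcover]
  exact (mk_union_le _ _).trans <| Cardinal.add_le_of_le hκ
    ((hC.mk_preimage_nonempty_le continuous_inl).trans (le_max_left _ _))
    ((hC.mk_preimage_nonempty_le continuous_inr).trans (le_max_right _ _))

theorem cellularity_sum : cellularity (X ⊕ Y) = max (cellularity X) (cellularity Y) :=
  cellularity_sum_le.antisymm <| max_le (cellularity_le_of_isOpenEmbedding .inl)
    (cellularity_le_of_isOpenEmbedding .inr)

end CardinalFunctions

section Products

variable {I : Type u} {Y : I → Type v} [∀ i, TopologicalSpace (Y i)]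

theorem exists_finset_forall_eq_mem {W : Set (∀ i, Y i)} (hW : IsOpen W) {z : ∀ i, Y i}
    (hz : z ∈ W) : ∃ F : Finset I, ∀ y : ∀ i, Y i, (∀ i ∈ F, y i = z i) → y ∈ W := by
  obtain ⟨F, u, hu, hFW⟩ := isOpen_pi_iff.1 hW z hz
  exact ⟨F, fun y hy => hFW fun i hi => hy i hi ▸ (hu i hi).2⟩

theorem perfectSpace_pi [Infinite I] [∀ i, Nontrivial (Y i)] : PerfectSpace (∀ i, Y i) := by
  classical
  refine perfectSpace_iff_forall_nontrivial.2 fun W hW ⟨z, hz⟩ => ?_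
  obtain ⟨F, hF⟩ := exists_finset_forall_eq_mem hW hz
  obtain ⟨i, hi⟩ := Infinite.exists_notMem_finset F
  obtain ⟨a, ha⟩ := exists_ne (z i)
  refine ⟨Function.update z i a, hF _ fun j hj => ?_, z, hz, fun h => ha ?_⟩
  · exact Function.update_of_ne (ne_of_mem_of_not_mem hj hi) _ _
  · rw [← h, Function.update_self]

theorem mk_finset_le (α : Type u) : #(Finset α) ≤ max ℵ₀ #α := by
  classical
  exact (mk_le_of_surjective List.toFinset_surjective).trans (mk_list_le_max α)

theorem mk_finset_sigma_le {κ : Cardinal.{max u v}} (hκ : ℵ₀ ≤ κ) (hI : lift.{v} #I ≤ κ)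
    {β : I → Type v} (hβ : ∀ i, lift.{u} #(β i) ≤ κ) : #(Finset (Σ i, β i)) ≤ κ := by
  refine (mk_finset_le _).trans (max_le hκ ?_)
  rw [mk_sigma]
  exact (sum_le_lift_mk_mul_iSup_lift _).trans (Cardinal.mul_le_of_le hκ hI (ciSup_le' hβ))

theorem piWeight_pi_le {κ : Cardinal.{max u v}} (hκ : ℵ₀ ≤ κ) (hI : lift.{v} #I ≤ κ)
    (hY : ∀ i, lift.{u} (piWeight (Y i)) ≤ κ) : piWeight (∀ i, Y i) ≤ κ := by
  classical
  choose B hB hBY using fun i => exists_isPiBase_mk_le_piWeight (Y i)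
  let box (q : Finset (Σ i, B i)) : Set (∀ i, Y i) := {y | ∀ p ∈ q, y p.1 ∈ p.2.1}
  have hbox (q : Finset (Σ i, B i)) : IsOpen (box q) := by
    simp only [box, ofPred_forall]
    exact isOpen_biInter_finset fun p _ => ((hB p.1).1 _ p.2.2).1.preimage (continuous_apply p.1)
  have hcard : #{q : Finset (Σ i, B i) // (box q).Nonempty} ≤ κ := (mk_subtype_le _).trans <|
    mk_finset_sigma_le hκ hI fun i => (lift_le.2 (hBY i)).trans (hY i)
  refine piWeight_le_of_family hκ hcard (fun q => box q) (fun q => hbox q) (fun q => q.2)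
    fun W hW ⟨z, hz⟩ => ?_
  obtain ⟨F, u, hu, hFW⟩ := isOpen_pi_iff.1 hW z hz
  choose V hVB hVu using fun i : F => (hB i).2 (u i) (hu i i.2).1 ⟨z i, (hu i i.2).2⟩
  choose y hy using fun i : F => ((hB i).1 (V i) (hVB i)).2
  refine ⟨⟨Finset.univ.image fun i : F => ⟨i, V i, hVB i⟩,
    fun i => if hi : i ∈ F then y ⟨i, hi⟩ else z i, ?_⟩, fun x hx => hFW fun i hi => ?_⟩
  · simp only [box, mem_ofPred_eq, Finset.forall_mem_image, Finset.mem_univ, forall_true_left,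
      Subtype.forall]
    intro i hi
    rw [dif_pos hi]
    exact hy ⟨i, hi⟩
  · exact hVu ⟨i, hi⟩ (hx _ (Finset.mem_image_of_mem _ (Finset.mem_univ ⟨i, hi⟩)))

theorem mk_le_piWeight_pi [∀ i, T1Space (Y i)] [∀ i, Nontrivial (Y i)] :
    lift.{v} #I ≤ piWeight (∀ i, Y i) := by
  classical
  obtain ⟨B, hB, hBpi⟩ := exists_isPiBase_mk_le_piWeight (∀ i, Y i)
  choose z hz using fun V : B => (hB.1 V V.2).2
  choose F hF using fun V : B => exists_finset_forall_eq_mem (hB.1 V V.2).1 (hz V)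
  have hcover : ⋃ V : B, (F V : Set I) = Set.univ := by
    refine eq_univ_of_forall fun i => mem_iUnion.2 ?_
    obtain ⟨a, b, hab⟩ := exists_pair_ne (Y i)
    obtain ⟨V, hV, hVa⟩ := hB.2 {y | y i ≠ a} (isOpen_ne.preimage (continuous_apply i))
      ⟨Function.update (fun j => Classical.arbitrary (Y j)) i b, by simpa using hab.symm⟩
    refine ⟨⟨V, hV⟩, by_contra fun hi => hVa (hF ⟨V, hV⟩ (Function.update (z ⟨V, hV⟩) i a)
      fun j hj => ?_) (Function.update_self _ _ _)⟩
    exact Function.update_of_ne (ne_of_mem_of_not_mem hj hi) _ _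
  have hκ : ℵ₀ ≤ piWeight (∀ i, Y i) := aleph0_le_piWeight
  calc lift.{v} #I = lift.{max u v} #(⋃ V : B, (F V : Set I)) := by
        rw [hcover, mk_univ, lift_umax.{u, v}]
    _ ≤ _ := mk_iUnion_le_lift _
    _ ≤ piWeight (∀ i, Y i) := Cardinal.mul_le_of_le hκ ((lift_id' _).trans_le hBpi) <|
        ciSup_le' fun V => (lift_le_aleph0.2 (mk_le_aleph0 (α := F V))).trans hκ

end Products

section DensePower

variable {X I : Type u} {Y : Type v} {e : I → Set X}

open scoped Classical in
theorem exists_finset_injOn_filter (he : Function.Injective e) (F : Finset I) :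
    ∃ D : Finset X, InjOn (fun i => {x ∈ D | x ∈ e i}) (F : Set I) := by
  have hsep (i j : I) (hij : i ≠ j) : ∃ x, ¬(x ∈ e i ↔ x ∈ e j) := by
    by_contra! h
    exact hij (he (Set.ext h))
  choose d hd using hsep
  refine ⟨F.offDiag.attach.image fun p => d p.1.1 p.1.2 (Finset.mem_offDiag.1 p.2).2.2,
    fun i hi j hj hfilter => by_contra fun hij => hd i j hij ?_⟩
  have hD := Finset.mem_image_of_mem
    (fun p : F.offDiag => d p.1.1 p.1.2 (Finset.mem_offDiag.1 p.2).2.2)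
    (Finset.mem_attach _ ⟨(i, j), Finset.mem_offDiag.2 ⟨hi, hj, hij⟩⟩)
  simpa only [Finset.mem_filter, hD, true_and] using Finset.ext_iff.1 hfilter (d i j hij)

open scoped Classical in
/-- The Hewitt–Marczewski–Pondiczery argument: coordinates are subsets `e i` of `X`, any finitely
many of which are told apart by their traces on a finite set. -/
theorem denseRange_apply_filter [TopologicalSpace Y] [Zero Y] (he : Function.Injective e) :
    DenseRange fun (q : Finset X × (Finset X →₀ Y)) i => q.2 {x ∈ q.1 | x ∈ e i} := by
  refine dense_iff_inter_open.2 fun W hW ⟨z, hz⟩ => ?_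
  obtain ⟨F, hF⟩ := exists_finset_forall_eq_mem hW hz
  obtain ⟨D, hD⟩ := exists_finset_injOn_filter he F
  let trace (i : F) : Finset X := {x ∈ D | x ∈ e i}
  have htrace : Function.Injective trace := injOn_iff_injective.1 hD
  let g : Finset X → Y := Function.extend trace (fun i => z i) 0
  have hg : (Function.support g).Finite := (finite_range trace).subset
    (Function.support_subset_iff'.2 fun t ht => Function.extend_apply' _ _ _ ht)
  exact ⟨_, hF _ fun i hi => htrace.extend_apply (fun i : F => z i) 0 ⟨i, hi⟩,
    (D, Finsupp.ofSupportFinite g hg), rfl⟩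

theorem exists_dense_pi_mk_le [TopologicalSpace Y] [Nontrivial Y] [Infinite X]
    (hI : #I ≤ #(Set X)) :
    ∃ Z : Set (I → Y), Dense Z ∧ #Z ≤ max (lift.{v} #X) (lift.{u} #Y) := by
  classical
  obtain ⟨e⟩ := hI
  let _ : Zero Y := ⟨Classical.arbitrary Y⟩
  refine ⟨_, denseRange_apply_filter e.injective, ?_⟩
  have hX : ℵ₀ ≤ max (lift.{v} #X) (lift.{u} #Y) :=
    (aleph0_le_lift.2 (aleph0_le_mk X)).trans (le_max_left _ _)
  refine mk_range_le.trans ?_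
  rw [mk_prod, mk_finsupp_lift_of_infinite, mk_finset_of_infinite, lift_umax.{u, v}]
  exact Cardinal.mul_le_of_le hX (le_max_left _ _) (lift_id'.{u, v} _).le

end DensePower

section CantorCubes

open MeasureTheory

theorem cellularity_eq_aleph0_of_isOpenPosMeasure {X : Type u} [TopologicalSpace X]
    [MeasurableSpace X] [OpensMeasurableSpace X] (μ : Measure X) [SFinite μ]
    [μ.IsOpenPosMeasure] : cellularity X = ℵ₀ := by
  refine (cellularity_le le_rfl fun C hC => ?_).antisymm aleph0_le_cellularity
  have hcount := Measure.countable_meas_pos_of_disjoint_iUnion (μ := μ)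
    (fun V : C => (hC.1 V V.2).1.measurableSet) fun _ _ h => hC.disjoint h
  have hpos : {V : C | 0 < μ V} = Set.univ :=
    eq_univ_of_forall fun V => (hC.1 V V.2).1.measure_pos μ (hC.1 V V.2).2
  rw [hpos] at hcount
  exact mk_le_aleph0_iff.2 (countable_univ_iff.1 hcount)

theorem cellularity_eq_aleph0_of_sigmaCompact_addGroup (G : Type u) [TopologicalSpace G]
    [AddGroup G] [IsTopologicalAddGroup G] [LocallyCompactSpace G] [SigmaCompactSpace G] :
    cellularity G = ℵ₀ := by
  let _ : MeasurableSpace G := borel G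
  have : BorelSpace G := ⟨rfl⟩
  exact cellularity_eq_aleph0_of_isOpenPosMeasure (Measure.addHaar : Measure G)

variable {I : Type u}

theorem isZeroDimensional_cantorCube : IsZeroDimensional (I → ZMod 2) :=
  isTopologicalBasis_isClopen

theorem piWeight_cantorCube [Infinite I] : piWeight (I → ZMod 2) = #I := by
  refine (piWeight_pi_le (aleph0_le_mk I) (lift_uzero _).le fun _ => ?_).antisymm ?_
  · exact (lift_le_aleph0.2 piWeight_le_aleph0).trans (aleph0_le_mk I)
  · exact (lift_uzero _).ge.trans (mk_le_piWeight_pi (Y := fun _ : I => ZMod 2))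

theorem exists_isZeroDimensional_piWeight_eq {X : Type u} [Infinite X] {κ : Cardinal.{u}}
    (hκ : ℵ₀ ≤ κ) (hκX : κ ≤ #(Set X)) :
    ∃ (Z : Type u) (_ : TopologicalSpace Z), IsZeroDimensional Z ∧ T2Space Z ∧ PerfectSpace Z ∧
      #Z ≤ #X ∧ piWeight Z = κ ∧ cellularity Z = ℵ₀ := by
  have : Infinite κ.out := infinite_iff.2 (hκ.trans_eq κ.mk_out.symm)
  obtain ⟨Z, hZ, hZX⟩ := exists_dense_pi_mk_le (Y := ZMod 2) (κ.mk_out.trans_le hκX)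
  have hincl := isPiEmbedding_preimage hZ.isDenseInducing_val
  have := perfectSpace_pi (Y := fun _ : κ.out => ZMod 2)
  refine ⟨Z, inferInstance, isZeroDimensional_cantorCube.of_isInducing .subtypeVal, inferInstance,
    hincl.perfectSpace, hZX.trans (max_le (lift_uzero _).le ?_), ?_, ?_⟩
  · exact (lift_le_aleph0.2 mk_le_aleph0).trans (aleph0_le_mk X)
  · rw [hincl.piWeight_eq isZeroDimensional_cantorCube.isSemiregular, piWeight_cantorCube, mk_out]
  · rw [hincl.cellularity_eq, cellularity_eq_aleph0_of_sigmaCompact_addGroup]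

end CantorCubes

section Theta

variable {X : Type u} [TopologicalSpace X]

theorem IsRegFilter.closure_inter_mem {F : Set (Set X)} (hF : IsRegFilter F) {U V : Set X}
    (hU : IsOpen U) (hV : IsOpen V) (hUF : closure U ∈ F) (hVF : closure V ∈ F) :
    closure (U ∩ V) ∈ F := by
  refine hF.mono _ (hF.meet_mem _ hUF _ hVF) _ (isRegClosed_closure (hU.inter hV)) ?_
  set O := interior (closure U ∩ closure V)
  have hOU : O ⊆ closure (O ∩ U) := fun x hx =>
    isOpen_interior.inter_closure ⟨hx, (interior_subset hx).1⟩
  have hUV : O ∩ U ⊆ closure (U ∩ V) := fun x hx =>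
    hU.inter_closure ⟨hx.2, (interior_subset hx.1).2⟩
  exact closure_minimal (hOU.trans (closure_minimal hUV isClosed_closure)) isClosed_closure

theorem IsRegFilter.inter_nonempty {F : Set (Set X)} (hF : IsRegFilter F) {U V : Set X}
    (hU : IsOpen U) (hV : IsOpen V) (hUF : closure U ∈ F) (hVF : closure V ∈ F) :
    (U ∩ V).Nonempty := by
  refine nonempty_iff_ne_empty.2 fun h => hF.empty_notMem ?_
  rw [← closure_empty, ← h]
  exact hF.closure_inter_mem hU hV hUF hVF

theorem isRegFilter_sUnion_of_isChain {c : Set (Set (Set X))} (hc : ∀ F ∈ c, IsRegFilter F)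
    (hchain : IsChain (· ⊆ ·) c) (hne : c.Nonempty) : IsRegFilter (⋃₀ c) where
  regClosed := fun A ⟨F, hF, hA⟩ => (hc F hF).regClosed A hA
  nonempty :=
    let ⟨F, hF⟩ := hne
    (hc F hF).nonempty.mono (subset_sUnion_of_mem hF)
  empty_notMem := fun ⟨F, hF, h⟩ => (hc F hF).empty_notMem h
  meet_mem := by
    rintro A ⟨F, hF, hA⟩ B ⟨G, hG, hB⟩
    rcases hchain.total hF hG with h | h
    · exact ⟨G, hG, (hc G hG).meet_mem A (h hA) B hB⟩
    · exact ⟨F, hF, (hc F hF).meet_mem A hA B (h hB)⟩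
  mono := fun A ⟨F, hF, hA⟩ B hB h => ⟨F, hF, (hc F hF).mono A hA B hB h⟩

theorem IsRegFilter.exists_isRegUltrafilter {G : Set (Set X)} (hG : IsRegFilter G) :
    ∃ F, G ⊆ F ∧ IsRegUltrafilter F :=
  zorn_subset_nonempty {F | IsRegFilter F} (fun c hc hchain hne =>
    ⟨⋃₀ c, isRegFilter_sUnion_of_isChain hc hchain hne, fun _ => subset_sUnion_of_mem⟩) G hG

theorem isRegFilter_mem_interior (x : X) : IsRegFilter {A | IsRegClosed A ∧ x ∈ interior A} where
  regClosed _ hA := hA.1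
  nonempty := ⟨univ, by simp [IsRegClosed]⟩
  empty_notMem h := by simpa using h.2
  meet_mem A hA B hB := by
    refine ⟨isRegClosed_closure isOpen_interior, isOpen_interior.subset_interior_closure ?_⟩
    rw [interior_inter]
    exact ⟨hA.2, hB.2⟩
  mono _ hA _ hB h := ⟨hB, interior_mono h hA.2⟩

theorem exists_isRegUltrafilter_mem_sInter (x : X) :
    ∃ F : Set (Set X), IsRegUltrafilter F ∧ x ∈ ⋂₀ F := by
  obtain ⟨F, hxF, hF⟩ := (isRegFilter_mem_interior x).exists_isRegUltrafilter
  refine ⟨F, hF, fun A hA => by_contra fun hxA => ?_⟩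
  have hAreg : closure (interior A) = A := hF.1.regClosed A hA
  have hAc : IsOpen Aᶜ := (hAreg ▸ isClosed_closure : IsClosed A).isOpen_compl
  have hAcF : closure Aᶜ ∈ F := hxF ⟨isRegClosed_closure hAc, hAc.subset_interior_closure hxA⟩
  obtain ⟨y, hyA, hyAc⟩ := hF.1.inter_nonempty isOpen_interior hAc (hAreg.symm ▸ hA) hAcF
  exact hyAc (interior_subset hyA)

theorem IsRegUltrafilter.closure_mem_of_mem_sInter {F : Set (Set X)} (hF : IsRegUltrafilter F)
    {x : X} (hx : x ∈ ⋂₀ F) {U : Set X} (hU : IsOpen U) (hxU : x ∈ U) : closure U ∈ F := by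
  refine (hF.mem_or hU).resolve_right fun h => ?_
  obtain ⟨y, hyU, hy⟩ := mem_closure_iff.1 (hx _ h) U hU hxU
  exact hy (subset_closure hyU)

variable {U V : Set X}

theorem lam_closure_mono (hV : IsOpen V) (h : U ⊆ V) : lam (closure U) ⊆ lam (closure V) :=
  fun F hF => F.2.1.mono _ hF _ (isRegClosed_closure hV) (closure_mono h)

theorem lam_closure_inter (hU : IsOpen U) (hV : IsOpen V) :
    lam (closure (U ∩ V)) = lam (closure U) ∩ lam (closure V) :=
  (subset_inter (lam_closure_mono hU inter_subset_left)
    (lam_closure_mono hV inter_subset_right)).antisymm fun F hF =>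
      F.2.1.closure_inter_mem hU hV hF.1 hF.2

theorem lam_empty : lam (∅ : Set X) = ∅ :=
  eq_empty_of_forall_notMem fun F => F.2.1.empty_notMem

theorem nonempty_of_lam_closure_nonempty (h : (lam (closure U)).Nonempty) : U.Nonempty := by
  rw [nonempty_iff_ne_empty] at h ⊢
  rintro rfl
  exact h (by rw [closure_empty, lam_empty])

theorem lam_closure_nonempty (hU : IsOpen U) (hne : U.Nonempty) : (lam (closure U)).Nonempty := by
  obtain ⟨x, hx⟩ := hne
  obtain ⟨F, hF, hxF⟩ := exists_isRegUltrafilter_mem_sInter x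
  exact ⟨⟨F, hF⟩, hF.closure_mem_of_mem_sInter hxF hU hx⟩

theorem disjoint_lam_closure (hU : IsOpen U) (hV : IsOpen V) (h : Disjoint U V) :
    Disjoint (lam (closure U)) (lam (closure V)) := by
  rw [disjoint_iff_inter_eq_empty, ← lam_closure_inter hU hV, h.inter_eq, closure_empty, lam_empty]

theorem lam_closure_compl (hU : IsOpen U) :
    lam (closure (closure U)ᶜ) = (lam (closure U))ᶜ := by
  refine subset_antisymm ?_ fun F hF => (F.2.mem_or hU).resolve_left hF
  exact (disjoint_lam_closure isClosed_closure.isOpen_compl hU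
    (disjoint_compl_left.mono_right subset_closure)).subset_compl_right

theorem isTopologicalBasis_lam_closure : TopologicalSpace.IsTopologicalBasis
    {s : Set (Theta X) | ∃ U, IsOpen U ∧ s = lam (closure U)} where
  exists_subset_inter := by
    rintro _ ⟨U, hU, rfl⟩ _ ⟨V, hV, rfl⟩ F hF
    exact ⟨_, ⟨U ∩ V, hU.inter hV, rfl⟩, (lam_closure_inter hU hV).superset hF,
      (lam_closure_inter hU hV).subset⟩
  sUnion_eq := by
    refine eq_univ_of_forall fun F => ?_
    obtain ⟨A, hA⟩ := F.2.1.nonempty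
    exact ⟨_, ⟨univ, isOpen_univ, rfl⟩, F.2.1.mono A hA _ (isRegClosed_closure isOpen_univ)
      ((subset_univ A).trans subset_closure)⟩
  eq_generateFrom := by
    refine congrArg TopologicalSpace.generateFrom (Set.ext fun s => ⟨?_, ?_⟩)
    · rintro ⟨A, hA, rfl⟩
      exact ⟨interior A, isOpen_interior, congrArg lam hA.symm⟩
    · rintro ⟨U, hU, rfl⟩
      exact ⟨_, isRegClosed_closure hU, rfl⟩

theorem isClopen_lam_closure (hU : IsOpen U) : IsClopen (lam (closure U)) := by
  have hopen {V : Set X} (hV : IsOpen V) : IsOpen (lam (closure V)) :=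
    isTopologicalBasis_lam_closure.isOpen ⟨V, hV, rfl⟩
  refine ⟨isOpen_compl_iff.1 ?_, hopen hU⟩
  rw [← lam_closure_compl hU]
  exact hopen isClosed_closure.isOpen_compl

theorem isZeroDimensional_theta : IsZeroDimensional (Theta X) := by
  refine isTopologicalBasis_lam_closure.of_isOpen_of_subset (fun s hs => hs.2) ?_
  rintro _ ⟨U, hU, rfl⟩
  exact isClopen_lam_closure hU

instance t2Space_theta : T2Space (Theta X) := by
  refine ⟨fun F G hFG => ?_⟩
  have hnot : ¬F.1 ⊆ G.1 := fun h => hFG (Subtype.ext (F.2.eq_of_le G.2.1 h))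
  obtain ⟨A, hAF, hAG⟩ := not_subset.1 hnot
  have hA : closure (interior A) = A := F.2.1.regClosed A hAF
  have hclopen : IsClopen (lam A) := hA ▸ isClopen_lam_closure isOpen_interior
  exact ⟨lam A, (lam A)ᶜ, hclopen.isOpen, hclopen.compl.isOpen, hAF, hAG, disjoint_compl_right⟩

theorem isPiEmbedding_lam_closure : IsPiEmbedding fun U : Set X => lam (closure U) where
  isOpen hU := (isClopen_lam_closure hU).isOpen
  nonempty := lam_closure_nonempty
  mono _ hV := lam_closure_mono hV
  disjoint := disjoint_lam_closure
  exists_subset hW hne := by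
    obtain ⟨_, ⟨U, hU, rfl⟩, hUne, hUW⟩ :=
      isTopologicalBasis_lam_closure.exists_nonempty_subset hne hW
    exact ⟨U, hU, nonempty_of_lam_closure_nonempty hUne, hUW⟩

/-- The supremum of a family of regular closed sets is the closure of its union, so that `λ` of this
supremum closes up the corresponding union of basic clopen sets. -/
theorem closure_eq_lam_closure_sUnion {W : Set (Theta X)} (hW : IsOpen W) :
    closure W = lam (closure (⋃₀ {U | IsOpen U ∧ lam (closure U) ⊆ W})) := by
  set O := ⋃₀ {U | IsOpen U ∧ lam (closure U) ⊆ W}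
  have hO : IsOpen O := isOpen_sUnion fun U hU => hU.1
  refine (closure_minimal (fun F hF => ?_) (isClopen_lam_closure hO).isClosed).antisymm
    fun F hF => isTopologicalBasis_lam_closure.mem_closure_iff.2 ?_
  · obtain ⟨_, ⟨U, hU, rfl⟩, hFU, hUW⟩ :=
      isTopologicalBasis_lam_closure.exists_subset_of_mem_open hF hW
    exact lam_closure_mono hO (subset_sUnion_of_mem (mem_ofPred.2 ⟨hU, hUW⟩)) hFU
  · rintro _ ⟨V, hV, rfl⟩ hFV
    obtain ⟨x, hxV, U, ⟨hU, hUW⟩, hxU⟩ := F.2.1.inter_nonempty hV hO hFV hF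
    exact (lam_closure_nonempty (hV.inter hU) ⟨x, hxV, hxU⟩).mono
      ((lam_closure_inter hV hU).trans_subset (inter_subset_inter_right _ hUW))

instance extremallyDisconnected_theta : ExtremallyDisconnected (Theta X) := by
  refine ⟨fun W hW => ?_⟩
  rw [closure_eq_lam_closure_sUnion hW]
  exact (isClopen_lam_closure (isOpen_sUnion fun U hU => hU.1)).isOpen

theorem denseRange_of_mem_sInter {f : X → Theta X} (hf : ∀ x, x ∈ ⋂₀ (f x).1) :
    DenseRange f := by
  refine dense_iff_inter_open.2 fun W hW hne => ?_
  obtain ⟨U, hU, ⟨x, hx⟩, hUW⟩ := isPiEmbedding_lam_closure.exists_subset hW hne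
  exact ⟨f x, hUW ((f x).2.closure_mem_of_mem_sInter (hf x) hU hx), mem_range_self x⟩

end Theta

section Sections

variable {X : Type u} [TopologicalSpace X] {s : X → IliadisAbsolute X}

theorem kMap_surjective [T2Space X] : Function.Surjective (kMap X) := fun x =>
  let ⟨F, hF, hxF⟩ := exists_isRegUltrafilter_mem_sInter x
  ⟨⟨⟨F, hF⟩, x, hxF⟩, (kMap_eq_iff _ x).2 hxF⟩

theorem existsUnique_mem_range_kMap_eq (hs : Function.RightInverse s (kMap X)) (x : X) :
    ∃! F, F ∈ range s ∧ kMap X F = x := by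
  refine ⟨s x, ⟨mem_range_self x, hs x⟩, ?_⟩
  rintro _ ⟨⟨y, rfl⟩, hy⟩
  rw [← hy, hs]

theorem denseRange_val_comp_section [T2Space X] (hs : Function.RightInverse s (kMap X)) :
    DenseRange fun x => (s x).1 :=
  denseRange_of_mem_sInter fun x => (kMap_eq_iff _ x).1 (hs x)

theorem dense_range_section [T2Space X] (hs : Function.RightInverse s (kMap X)) :
    Dense (range s) := by
  refine IsInducing.subtypeVal.dense_iff.2 fun F => ?_
  exact closure_mono (range_subset_iff.2 fun x => mem_image_of_mem _ (mem_range_self x))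
    (denseRange_val_comp_section hs F.1)

theorem isDenseInducing_range_section [T2Space X] (hs : Function.RightInverse s (kMap X)) :
    IsDenseInducing fun p : range s => p.1.1 where
  toIsInducing := IsInducing.subtypeVal.comp .subtypeVal
  dense := (denseRange_val_comp_section hs).mono
    (range_subset_iff.2 fun x => ⟨⟨s x, mem_range_self x⟩, rfl⟩)

theorem isPiEmbedding_section [T2Space X] (hs : Function.RightInverse s (kMap X)) :
    IsPiEmbedding fun U : Set X => {p : range s | closure U ∈ p.1.1.1} :=
  (isPiEmbedding_preimage (isDenseInducing_range_section hs)).comp isPiEmbedding_lam_closure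

theorem exists_dense_transversal_kMap (X : Type u) [TopologicalSpace X] [T2Space X]
    [PerfectSpace X] :
    ∃ S : Set (IliadisAbsolute X),
      Dense S ∧ (∀ x : X, ∃! F, F ∈ S ∧ kMap X F = x) ∧
      ExtremallyDisconnected S ∧ IsZeroDimensional S ∧ T2Space S ∧ PerfectSpace S ∧ IsSHD S ∧
      #S = #X ∧ cellularity S = cellularity X ∧ piWeight S ≤ piWeight X ∧
      (IsSemiregular X → piWeight S = piWeight X) := by
  obtain ⟨s, hs⟩ := (kMap_surjective (X := X)).hasRightInverse
  have hdense := isDenseInducing_range_section hs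
  have hT := isPiEmbedding_section hs
  have hED := extremallyDisconnected_of_isDenseInducing hdense
  have hperfect := hT.perfectSpace
  exact ⟨range s, dense_range_section hs, existsUnique_mem_range_kMap_eq hs, hED,
    isZeroDimensional_theta.of_isInducing hdense.isInducing, inferInstance, hperfect,
    isSHD_of_extremallyDisconnected _, mk_range_eq s hs.injective, hT.cellularity_eq,
    hT.piWeight_le, hT.piWeight_eq⟩

theorem exists_isZeroDimensional_cardinals_eq (X : Type u) [TopologicalSpace X] [T2Space X]
    [PerfectSpace X] :
    ∃ (Y : Type u) (_ : TopologicalSpace Y), IsZeroDimensional Y ∧ T2Space Y ∧ PerfectSpace Y ∧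
      #Y = #X ∧ piWeight Y = piWeight X ∧ cellularity Y = cellularity X := by
  rcases isEmpty_or_nonempty X with hX | hX
  · exact ⟨X, inferInstance, isTopologicalBasis_isClopen, inferInstance, inferInstance, rfl, rfl,
      rfl⟩
  have : Infinite X := infinite_univ_iff.1 (infinite_of_isOpen isOpen_univ univ_nonempty)
  obtain ⟨S, -, -, -, hS, _, _, -, hSX, hSc, hSπ, -⟩ := exists_dense_transversal_kMap X
  obtain ⟨Z, _, hZ, _, _, hZX, hZπ, hZc⟩ :=
    exists_isZeroDimensional_piWeight_eq (X := X) aleph0_le_piWeight piWeight_le_mk_set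
  refine ⟨S ⊕ Z, inferInstance, hS.sum hZ, inferInstance, inferInstance, ?_, ?_, ?_⟩
  · rw [← Cardinal.add_def, hSX]
    exact add_eq_left (aleph0_le_mk X) hZX
  · rw [piWeight_sum, hZπ, max_eq_right hSπ]
  · rw [cellularity_sum, hSc, hZc, max_eq_left aleph0_le_cellularity]

end Sections

end Absolute

open Absolute in
theorem mainTheorem2 (X : Type u) [TopologicalSpace X] [T2Space X] [PerfectSpace X] :
    (∃ (sX : Type u) (_ : TopologicalSpace sX),
      ExtremallyDisconnected sX ∧ IsZeroDimensional sX ∧ T2Space sX ∧ PerfectSpace sX ∧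
      IsSHD sX ∧
      #sX = #X ∧ piWeight sX = piWeight X ∧ cellularity sX = cellularity X) ∧
    (∃ sX : Set (IliadisAbsolute X),
      Dense sX ∧ (∀ x : X, ∃! F, F ∈ sX ∧ kMap X F = x) ∧
      ExtremallyDisconnected sX ∧ IsZeroDimensional sX ∧ T2Space sX ∧ PerfectSpace sX ∧
      IsSHD sX ∧
      #sX = #X ∧ cellularity sX = cellularity X ∧ piWeight sX ≤ piWeight X ∧
      (IsSemiregular X → piWeight sX = piWeight X)) := by
  refine ⟨?_, exists_dense_transversal_kMap X⟩
  obtain ⟨Y, _, hY, _, _, hYX, hYπ, hYc⟩ := exists_isZeroDimensional_cardinals_eq X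
  obtain ⟨S, -, -, hED, hS, hT2, hperfect, hSHD, hSY, hSc, -, hSπ⟩ :=
    exists_dense_transversal_kMap Y
  exact ⟨S, inferInstance, hED, hS, hT2, hperfect, hSHD, hSY.trans hYX,
    (hSπ hY.isSemiregular).trans hYπ, hSc.trans hYc⟩
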